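/- Let $S\subseteq\mathbb{R}^d$ be closed with $0<|S|<\infty$, where $|\cdot|$ is Lebesgue measure. Let $\Gamma$ be a finite index set, let $\phi_\gamma:\mathbb{R}^d\to\mathbb{R}$ ($\gamma\in\Gamma$) be Lebesgue measurable functions, and let $u=(u_\gamma)_{\gamma\in\Gamma}\in\mathbb{R}^\Gamma$. Assume that there is $L\in\mathbb{R}$ with $\phi_\gamma\ge L$ a.e. for all $\gamma\in\Gamma$. A pdf is a Lebesgue measurable function $\pi$ on $\mathbb{R}^d$ with $\pi\ge 0$ a.e. and $\int\pi=1$; write $\mathrm{supp}(\pi)=\{x:\pi(x)\neq 0\}$, $\mathbb{E}_\pi[f]=\int f\pi$ and $h(\pi)=-\mathbb{E}_\pi[\ln\pi]$ (with $0\ln 0=0$), the integrals being extended-real Lebesgue integrals. Let $\Omega(u)$ be the set of all pdfs $\pi$ with $\mathrm{supp}(\pi)\subseteq S$ up to a null set and $\mathbb{E}_\pi[\phi_\gamma]\le u_\gamma$ for all $\gamma\in\Gamma$ (the expectations being well defined). Assume that $\Omega(u)$ is nonempty and that $$C:=\{x\in S:\ \phi_\gamma(x)\le u_\gamma\ \text{for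 all }\gamma\in\Gamma\}$$ has positive Lebesgue measure. Then $h(\pi)$ is well defined in $[-\infty,+\infty]$ for every $\pi\in\Omega(u)$, and there is a pdf $\pi_{ME}\in\Omega(u)$, unique up to equality a.e., with $h(\pi_{ME})=\max_{\pi\in\Omega(u)}h(\pi)$. Its entropy is finite, with $$\ln|C|\ \le\ h(\pi_{ME})\ \le\ \ln|S| .$$ Moreover, for a suitable choice of $\pi_{ME}$ within its a.e.-equivalence class, $S_{ME}:=\mathrm{supp}(\pi_{ME})\subseteq S$, and there are real numbers $\lambda_\gamma\ge 0$ ($\gamma\in\Gamma$) such that, with $$\alpha:=\ln\int_{S_{ME}}\exp\Big\{-\sum_{\gamma\in\Gamma}\lambda_\gamma\phi_\gamma(x)\Big\}\,dx ,$$ the integral being finite and positive, the following hold. 1. $\displaystyle \pi_{ME}(x)=\mathbf{1}_{S_{ME}}(x)\exp\Big\{-\alpha-\sum_{\gamma\in\Gamma}\lambda_\gamma\phi_\gamma(x)\Big\}$ for all $x\in\mathbb{R}^d$. 2. $\mathbb{E}_\pi[\mathbf{1}_{S\setminus S_{ME}}]=0$ for every $\pi\in\Omega(u)$ with $h(\pi)>-\infty$.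 3. The means $\mathbb{E}_{\pi_{ME}}[\phi_\gamma]$ are finite and $\displaystyle\sum_{\gamma\in\Gamma}\lambda_\gamma\big(\mathbb{E}_{\pi_{ME}}[\phi_\gamma]-u_\gamma\big)=0$. 4. $\displaystyle h(\pi_{ME})=\alpha+\sum_{\gamma\in\Gamma}\lambda_\gamma\mathbb{E}_{\pi_{ME}}[\phi_\gamma]=\alpha+\sum_{\gamma\in\Gamma}u_\gamma\lambda_\gamma$. -/

import Mathlib

open MeasureTheory

namespace MaxEnt

noncomputable section

/-- The Lebesgue integral of `f` over `ℝ^d` is well defined in the extended reals: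
the positive and the negative part do not both have infinite integral. -/
def IntegralDefined {d : ℕ} (f : EuclideanSpace ℝ (Fin d) → ℝ) : Prop :=
  (∫⁻ x, ENNReal.ofReal (f x)) ≠ ⊤ ∨ (∫⁻ x, ENNReal.ofReal (-f x)) ≠ ⊤

/-- The extended-real Lebesgue integral of `f` over `ℝ^d`, positive part minus negative part
(meaningful when `IntegralDefined f`). -/
def extIntegral {d : ℕ} (f : EuclideanSpace ℝ (Fin d) → ℝ) : EReal :=
  ((∫⁻ x, ENNReal.ofReal (f x) : ENNReal) : EReal) -
    ((∫⁻ x, ENNReal.ofReal (-f x) : ENNReal) : EReal)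

/-- A probability density function on `ℝ^d`: Lebesgue measurable, nonnegative almost everywhere,
with integral one. -/
structure IsPdf {d : ℕ} (p : EuclideanSpace ℝ (Fin d) → ℝ) : Prop where
  aemeasurable : AEMeasurable p volume
  nonneg : ∀ᵐ x, 0 ≤ p x
  lintegral_eq_one : (∫⁻ x, ENNReal.ofReal (p x)) = 1

/-- The expectation `E_p[f] = ∫ f p` is well defined in the extended reals. -/
def ExpectationDefined {d : ℕ} (p f : EuclideanSpace ℝ (Fin d) → ℝ) : Prop :=
  IntegralDefined (fun x => f x * p x)

/-- The expectation `E_p[f] = ∫ f p` as an extended real. -/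
def expectation {d : ℕ} (p f : EuclideanSpace ℝ (Fin d) → ℝ) : EReal :=
  extIntegral (fun x => f x * p x)

/-- The differential entropy of `p` is well defined. -/
def EntropyDefined {d : ℕ} (p : EuclideanSpace ℝ (Fin d) → ℝ) : Prop :=
  ExpectationDefined p (fun x => Real.log (p x))

/-- The differential entropy `h(p) = - E_p[ln p]`, where `0 ln 0 = 0`. -/
def entropy {d : ℕ} (p : EuclideanSpace ℝ (Fin d) → ℝ) : EReal :=
  -expectation p (fun x => Real.log (p x))

/-- The moment class `Ω(u)`: the pdfs supported in `S` (up to a null set) with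
`E_p[φ γ] ≤ u γ` for all `γ`. -/
def momentClass {d : ℕ} {Γ : Type*} (S : Set (EuclideanSpace ℝ (Fin d)))
    (φ : Γ → EuclideanSpace ℝ (Fin d) → ℝ) (u : Γ → ℝ) :
    Set (EuclideanSpace ℝ (Fin d) → ℝ) :=
  {p | IsPdf p ∧ volume (Function.support p \ S) = 0 ∧
    ∀ γ, ExpectationDefined p (φ γ) ∧ expectation p (φ γ) ≤ (u γ : EReal)}

/-- `p` belongs to `F` and attains the maximum of the differential entropy over `F`
(the entropy being well defined for all members of `F`). -/
def IsMaxEnt {d : ℕ} (F : Set (EuclideanSpace ℝ (Fin d) → ℝ))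
    (p : EuclideanSpace ℝ (Fin d) → ℝ) : Prop :=
  p ∈ F ∧ ∀ q ∈ F, EntropyDefined q ∧ entropy q ≤ entropy p

/-- The set `C = ⋂ γ, {x ∈ S : φ γ x ≤ u γ}`, with `C = S` when there is no constraint. -/
def feasibleSet {d : ℕ} {Γ : Type*} (S : Set (EuclideanSpace ℝ (Fin d)))
    (φ : Γ → EuclideanSpace ℝ (Fin d) → ℝ) (u : Γ → ℝ) :
    Set (EuclideanSpace ℝ (Fin d)) :=
  {x | x ∈ S ∧ ∀ γ, φ γ x ≤ u γ}

end

end MaxEnt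

/-! On `S`, a set of finite measure, the entropy integrand is bounded above by 1 and is strictly
concave in the density, while the constraints are linear. This alone gives existence, uniqueness and
the exponential form, without weak compactness and without a constraint qualification.

Existence and uniqueness come from a quantitative form of strict concavity
(`abs_sub_le_negMulLog_gap`): two densities whose entropies are close to the supremum are close in
`L¹` (`integral_abs_sub_le`), since their midpoint is again feasible. Maximizing sequences are
therefore Cauchy, and Fatou's lemma, applied to `φ γ - L` and to one minus the entropy integrand,
passes the constraints and the entropy bound to the limit. The uniform density on the feasible set
shows that finite entropy is attainable and gives the lower bound; the tangent at the uniform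
density on `S` gives the upper bound.

For the exponential form, the maximizer `p` is perturbed to `(1 + ε g) p` with `g` bounded. To first
order in `ε`, every `g` that keeps the mass and does not raise an active moment cannot raise the
entropy (`IsMaximizer.integral_mul_ent_le`). Farkas' lemma on the space of simple functions turns
this implication into multipliers, and testing on indicators gives a pointwise formula for `log p`
where `p ≠ 0`. That no competitor of finite entropy charges the zero set of `p` is due to the
infinite slope of `-x log x` at 0 (`IsMaximizer.ae_eq_zero_of_eq_zero`). -/

namespace MaxEnt

open Filter Topology

/-! ### Linear algebra: Farkas' lemma -/

/-- **Farkas' lemma** for finitely many linear functionals on an arbitrary real vector space. -/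
theorem farkas_functionals {V ι : Type*} [AddCommGroup V] [Module ℝ V] (s : Finset ι) :
    ∀ (f : ι → V →ₗ[ℝ] ℝ) (l : V →ₗ[ℝ] ℝ),
      (∀ g, (∀ i ∈ s, f i g ≤ 0) → l g ≤ 0) →
      ∃ lam : ι → ℝ, (∀ i, 0 ≤ lam i) ∧ ∀ g, l g = ∑ i ∈ s, lam i * f i g := by
  classical
  induction s using Finset.induction_on with
  | empty =>
    intro f l h
    refine ⟨0, fun _ => le_rfl, fun g => ?_⟩
    have h1 := h g (by simp)
    have h2 := h (-g) (by simp)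
    simp only [map_neg] at h2
    simp only [Finset.sum_empty]
    linarith
  | insert a s ha ih =>
    intro f l h
    by_cases hs : ∀ g, (∀ i ∈ s, f i g ≤ 0) → l g ≤ 0
    · obtain ⟨lam, h0, h1⟩ := ih f l hs
      refine ⟨Function.update lam a 0, fun i => ?_, fun g => ?_⟩
      · by_cases hi : i = a
        · simp [hi]
        · simpa [hi] using h0 i
      · rw [Finset.sum_insert ha, h1]
        simp only [Function.update_self, zero_mul, zero_add]
        refine Finset.sum_congr rfl fun i hi => ?_
        rw [Function.update_of_ne (ne_of_mem_of_not_mem hi ha)]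
    · push Not at hs
      obtain ⟨g0, hg0, hl0⟩ := hs
      have hpos : 0 < f a g0 := by
        by_contra! hc
        exact absurd (h g0 fun i hi => (Finset.mem_insert.1 hi).elim (fun e => e ▸ hc) (hg0 i))
          (not_le.2 hl0)
      -- `P` projects onto the kernel of `f a` along `g0`. On its range the constraint `a` is void,
      -- so the induction hypothesis applies to the composed functionals.
      set P : V →ₗ[ℝ] V := LinearMap.id - (f a).smulRight ((f a g0)⁻¹ • g0) with hP
      have hPa : ∀ g, P g = g - (f a g * (f a g0)⁻¹) • g0 := fun g => by
        simp [hP, smul_smul]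
      have hfa : ∀ g, f a (P g) = 0 := fun g => by
        rw [hPa, map_sub, map_smul, smul_eq_mul, mul_assoc, inv_mul_cancel₀ hpos.ne', mul_one,
          sub_self]
      obtain ⟨lam, h0, h1⟩ := ih (fun i => (f i).comp P) (l.comp P) fun g hg =>
        h (P g) fun i hi => (Finset.mem_insert.1 hi).elim (fun e => by rw [e, hfa]) (hg i)
      -- The identity at `g0` forces the value at `a`. It is nonnegative because `l g0 > 0`, while
      -- every `f i g0` with `i ∈ s` is nonpositive.
      refine ⟨Function.update lam a ((l g0 - ∑ i ∈ s, lam i * f i g0) * (f a g0)⁻¹),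
        fun i => ?_, fun g => ?_⟩
      · by_cases hi : i = a
        · subst hi
          rw [Function.update_self]
          refine mul_nonneg ?_ (inv_nonneg.2 hpos.le)
          have : ∑ i ∈ s, lam i * f i g0 ≤ 0 :=
            Finset.sum_nonpos fun i hi => mul_nonpos_of_nonneg_of_nonpos (h0 i) (hg0 i hi)
          linarith
        · simpa [hi] using h0 i
      · have h2 := h1 g
        simp only [LinearMap.comp_apply, hPa, map_sub, map_smul, smul_eq_mul] at h2
        have h3 : ∑ i ∈ s, lam i * (f i g - f a g * (f a g0)⁻¹ * f i g0)
            = ∑ i ∈ s, lam i * f i g - f a g * (f a g0)⁻¹ * ∑ i ∈ s, lam i * f i g0 := by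
          rw [Finset.mul_sum, ← Finset.sum_sub_distrib]
          exact Finset.sum_congr rfl fun i _ => by ring
        rw [h3] at h2
        rw [Finset.sum_insert ha, Function.update_self]
        have h4 : ∑ i ∈ s, Function.update lam a
            ((l g0 - ∑ i ∈ s, lam i * f i g0) * (f a g0)⁻¹) i * f i g
            = ∑ i ∈ s, lam i * f i g :=
          Finset.sum_congr rfl fun i hi => by
            rw [Function.update_of_ne (ne_of_mem_of_not_mem hi ha)]
        rw [h4]
        linarith

/-! ### Pointwise inequalities for `-x log x` -/

theorem negMulLog_le_one {x : ℝ} (hx : 0 ≤ x) : Real.negMulLog x ≤ 1 :=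
  (Real.negMulLog_le_one_sub_self hx).trans (by linarith)

/-- The tangent line of `negMulLog` at `c` lies above its graph. -/
theorem negMulLog_le_tangent {x c : ℝ} (hx : 0 ≤ x) (hc : 0 < c) :
    Real.negMulLog x ≤ c - x - x * Real.log c := by
  rcases hx.eq_or_lt with rfl | hx
  · simpa using hc.le
  · have h := Real.log_le_sub_one_of_pos (div_pos hc hx)
    rw [Real.log_div hc.ne' hx.ne'] at h
    have h1 : x * (Real.log c - Real.log x) ≤ x * (c / x - 1) :=
      mul_le_mul_of_nonneg_left h hx.le
    have h2 : x * (c / x - 1) = c - x := by field_simp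
    rw [Real.negMulLog]
    linarith

/-- This is `log t ≤ t - 1` at `t = √(m / a)`. Taking the square root first bounds relative entropy
below by a Hellinger distance. -/
theorem mul_log_sub_mul_log_ge {a m : ℝ} (ha : 0 ≤ a) (hm : 0 < m) :
    2 * a - 2 * (√a * √m) ≤ -Real.negMulLog a - a * Real.log m := by
  rcases ha.eq_or_lt with rfl | ha
  · simp
  · have hsa := Real.sqrt_pos.2 ha
    have hsm := Real.sqrt_pos.2 hm
    have h := Real.log_le_sub_one_of_pos (div_pos hsm hsa)
    rw [Real.log_div hsm.ne' hsa.ne', Real.log_sqrt hm.le, Real.log_sqrt ha.le] at h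
    have h1 : 2 * a * (Real.log m / 2 - Real.log a / 2) ≤ 2 * a * (√m / √a - 1) :=
      mul_le_mul_of_nonneg_left h (by linarith)
    have h2 : a * (√m / √a) = √a * √m := by
      nth_rewrite 1 [← Real.mul_self_sqrt ha.le]
      field_simp
    rw [Real.negMulLog]
    nlinarith

/-- Quantitative midpoint concavity of `negMulLog`. -/
theorem abs_sub_le_negMulLog_gap {a b η : ℝ} (ha : 0 ≤ a) (hb : 0 ≤ b) (hη : 0 < η) :
    |a - b| ≤ (2 * Real.negMulLog ((a + b) / 2) - Real.negMulLog a - Real.negMulLog b) / η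
      + η * (a + b) := by
  rcases (add_nonneg ha hb).eq_or_lt with h0 | h0
  · have : a = 0 := by linarith
    have : b = 0 := by linarith
    subst a b
    simp
  set m := (a + b) / 2 with hm
  have hm0 : 0 < m := by positivity
  have h1 := mul_log_sub_mul_log_ge ha hm0
  have h2 := mul_log_sub_mul_log_ge hb hm0
  have h3 : Real.negMulLog m = -(m * Real.log m) := by simp [Real.negMulLog]
  have hx := Real.mul_self_sqrt ha
  have hy := Real.mul_self_sqrt hb
  have hz := Real.mul_self_sqrt hm0.le
  have hx0 := Real.sqrt_nonneg a
  have hy0 := Real.sqrt_nonneg b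
  set x := √a
  set y := √b
  set z := √m
  -- Adding `h1` and `h2` and using `x² + y² = 2 z²`, the surplus over the left side is `(x + y -
  -- 2z)² / 2`.
  have hgap : (x - y) ^ 2 / 2 ≤ 2 * Real.negMulLog m - Real.negMulLog a - Real.negMulLog b := by
    have e : a * Real.log m + b * Real.log m = 2 * (m * Real.log m) := by rw [hm]; ring
    nlinarith [sq_nonneg (x + y - 2 * z)]
  set G := 2 * Real.negMulLog m - Real.negMulLog a - Real.negMulLog b
  -- Weighted AM-GM for `|x - y| (x + y)`. A free `η` keeps the bound linear in the gap, so it can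
  -- be integrated without Cauchy-Schwarz.
  have key : |a - b| ≤ (x - y) ^ 2 / 2 / η + η * (x + y) ^ 2 / 2 := by
    have e1 : |a - b| = |x - y| * (x + y) := by
      rw [show a - b = (x - y) * (x + y) by linear_combination -hx + hy, abs_mul,
        abs_of_nonneg (add_nonneg hx0 hy0)]
    rw [e1, ← sq_abs (x - y)]
    have : |x - y| ^ 2 / 2 / η + η * (x + y) ^ 2 / 2 - |x - y| * (x + y)
        = (|x - y| - η * (x + y)) ^ 2 / (2 * η) := by field_simp; ring
    have h5 : 0 ≤ (|x - y| - η * (x + y)) ^ 2 / (2 * η) := by positivity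
    linarith
  have k1 : (x - y) ^ 2 / 2 / η ≤ G / η := by gcongr
  have k2 : η * (x + y) ^ 2 / 2 ≤ η * (a + b) := by
    have : (x + y) ^ 2 / 2 ≤ a + b := by nlinarith [sq_nonneg (x - y)]
    calc η * (x + y) ^ 2 / 2 = η * ((x + y) ^ 2 / 2) := by ring
      _ ≤ _ := by gcongr
  linarith

/-- Upper bound for the loss of entropy under a multiplicative perturbation. -/
theorem negMulLog_perturb_ge {p ε g : ℝ} (hp : 0 ≤ p) (hg : 0 ≤ 1 + ε * g) :
    (1 + ε * g) * Real.negMulLog p - p * (ε * g + ε ^ 2 * g ^ 2)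
      ≤ Real.negMulLog ((1 + ε * g) * p) := by
  have h1 := negMulLog_le_tangent hg one_pos
  rw [Real.negMulLog_mul]
  have h2 : -((1 + ε * g) * (ε * g)) ≤ Real.negMulLog (1 + ε * g) := by
    rcases hg.eq_or_lt with h | h
    · simp [← h]
    · have := Real.log_le_sub_one_of_pos h
      rw [Real.negMulLog]
      nlinarith
  nlinarith

theorem negMulLog_mix_ge {p q t : ℝ} (hp : 0 ≤ p) (hq : 0 ≤ q) (ht : 0 ≤ t) (ht1 : t ≤ 1) :
    (1 - t) * Real.negMulLog p + t * Real.negMulLog q ≤ Real.negMulLog ((1 - t) * p + t * q) := by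
  have := Real.concaveOn_negMulLog.2 (Set.mem_Ici.2 hp) (Set.mem_Ici.2 hq)
    (sub_nonneg.2 ht1) ht (by ring)
  simpa using this

/-! ### Entropy maximization over densities on a measure space -/

section Core

variable {X : Type*} [MeasurableSpace X] {ν : Measure X} {Γ : Type*}

/-- Densities with respect to `ν` with integrable moments `∫ φ γ p ≤ u γ`. -/
structure IsFeasible (ν : Measure X) (φ : Γ → X → ℝ) (u : Γ → ℝ) (p : X → ℝ) : Prop where
  integrable : Integrable p ν
  nonneg : ∀ᵐ x ∂ν, 0 ≤ p x
  integral_eq_one : ∫ x, p x ∂ν = 1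
  integrable_mul : ∀ γ, Integrable (fun x => φ γ x * p x) ν
  integral_mul_le : ∀ γ, ∫ x, φ γ x * p x ∂ν ≤ u γ

/-- A feasible density with finite entropy `∫ negMulLog p`. -/
structure IsFinEnt (ν : Measure X) (φ : Γ → X → ℝ) (u : Γ → ℝ) (p : X → ℝ) : Prop
    extends IsFeasible ν φ u p where
  integrable_ent : Integrable (fun x => Real.negMulLog (p x)) ν

/-- A maximizer of the entropy among the feasible densities of finite entropy. -/
structure IsMaximizer (ν : Measure X) (φ : Γ → X → ℝ) (u : Γ → ℝ) (p : X → ℝ) : Prop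
    extends IsFinEnt ν φ u p where
  le : ∀ q, IsFinEnt ν φ u q →
    ∫ x, Real.negMulLog (q x) ∂ν ≤ ∫ x, Real.negMulLog (p x) ∂ν

theorem integrable_of_ae_between {f g k : X → ℝ} (hf : Integrable f ν) (hk : Integrable k ν)
    (hg : AEStronglyMeasurable g ν) (h1 : ∀ᵐ x ∂ν, f x ≤ g x) (h2 : ∀ᵐ x ∂ν, g x ≤ k x) :
    Integrable g ν := by
  refine (hf.abs.add hk.abs).mono' hg ?_
  filter_upwards [h1, h2] with x h1 h2
  simp only [Pi.add_apply, Real.norm_eq_abs]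
  refine abs_le.2 ⟨?_, ?_⟩
  · linarith [neg_abs_le (f x), abs_nonneg (k x)]
  · linarith [le_abs_self (k x), abs_nonneg (f x)]

/-- Fatou's lemma for nonnegative real functions with bounded integrals. -/
theorem integrable_and_integral_le_of_tendsto {f : ℕ → X → ℝ} {g : X → ℝ} {c : ℕ → ℝ} {b : ℝ}
    (hf : ∀ n, Integrable (f n) ν) (h0 : ∀ n, ∀ᵐ x ∂ν, 0 ≤ f n x)
    (hc : ∀ n, ∫ x, f n x ∂ν ≤ c n) (hcb : Tendsto c atTop (𝓝 b))
    (hg : AEStronglyMeasurable g ν)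
    (hfg : ∀ᵐ x ∂ν, Tendsto (fun n => f n x) atTop (𝓝 (g x))) :
    Integrable g ν ∧ ∫ x, g x ∂ν ≤ b := by
  have hg0 : ∀ᵐ x ∂ν, 0 ≤ g x := by
    filter_upwards [ae_all_iff.2 h0, hfg] with x hx h
    exact ge_of_tendsto' h hx
  have hb0 : 0 ≤ b := ge_of_tendsto' hcb fun n => (integral_nonneg_of_ae (h0 n)).trans (hc n)
  have key : ∫⁻ x, ENNReal.ofReal (g x) ∂ν ≤ ENNReal.ofReal b := by
    calc ∫⁻ x, ENNReal.ofReal (g x) ∂ν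
        = ∫⁻ x, liminf (fun n => ENNReal.ofReal (f n x)) atTop ∂ν := by
          refine lintegral_congr_ae ?_
          filter_upwards [hfg] with x hx
          exact ((ENNReal.continuous_ofReal.tendsto _).comp hx).liminf_eq.symm
      _ ≤ liminf (fun n => ∫⁻ x, ENNReal.ofReal (f n x) ∂ν) atTop :=
          lintegral_liminf_le' fun n => (hf n).aemeasurable.ennreal_ofReal
      _ ≤ liminf (fun n => ENNReal.ofReal (c n)) atTop := by
          refine liminf_le_liminf (Eventually.of_forall fun n => ?_)
          rw [← ofReal_integral_eq_lintegral_ofReal (hf n) (h0 n)]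
          exact ENNReal.ofReal_le_ofReal (hc n)
      _ = ENNReal.ofReal b := ((ENNReal.continuous_ofReal.tendsto _).comp hcb).liminf_eq
  have hgi : Integrable g ν :=
    (lintegral_ofReal_ne_top_iff_integrable hg hg0).1 (key.trans_lt ENNReal.ofReal_lt_top).ne
  refine ⟨hgi, ?_⟩
  rw [← ofReal_integral_eq_lintegral_ofReal hgi hg0] at key
  exact (ENNReal.ofReal_le_ofReal_iff hb0).1 key

theorem IsFeasible.mix {φ : Γ → X → ℝ} {u : Γ → ℝ} {p q : X → ℝ} {t : ℝ} (ht : 0 ≤ t) (ht1 : t ≤ 1) (hp : IsFeasible ν φ u p)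
    (hq : IsFeasible ν φ u q) : IsFeasible ν φ u (fun x => (1 - t) * p x + t * q x) where
  integrable := (hp.integrable.const_mul _).add (hq.integrable.const_mul _)
  nonneg := by
    filter_upwards [hp.nonneg, hq.nonneg] with x h1 h2
    have := sub_nonneg.2 ht1
    positivity
  integral_eq_one := by
    rw [integral_add (hp.integrable.const_mul _) (hq.integrable.const_mul _),
      integral_const_mul, integral_const_mul, hp.integral_eq_one, hq.integral_eq_one]
    ring
  integrable_mul γ := by
    refine (((hp.integrable_mul γ).const_mul (1 - t)).add
      ((hq.integrable_mul γ).const_mul t)).congr (Eventually.of_forall fun x => ?_)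
    simp only [Pi.add_apply]
    ring
  integral_mul_le γ := by
    have e : ∀ x, φ γ x * ((1 - t) * p x + t * q x)
        = (1 - t) * (φ γ x * p x) + t * (φ γ x * q x) := fun x => by ring
    simp_rw [e]
    rw [integral_add ((hp.integrable_mul γ).const_mul _) ((hq.integrable_mul γ).const_mul _),
      integral_const_mul, integral_const_mul]
    nlinarith [hp.integral_mul_le γ, hq.integral_mul_le γ]

/-! ### Finite measures: existence and uniqueness of the maximizer -/

section FiniteMeasure

variable [IsFiniteMeasure ν] {φ : Γ → X → ℝ} {u : Γ → ℝ} {p q : X → ℝ}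

theorem integrable_negMulLog_of_le {f : X → ℝ} (hf : Integrable f ν)
    (hp : AEStronglyMeasurable p ν) (h0 : ∀ᵐ x ∂ν, 0 ≤ p x)
    (h : ∀ᵐ x ∂ν, f x ≤ Real.negMulLog (p x)) :
    Integrable (fun x => Real.negMulLog (p x)) ν :=
  integrable_of_ae_between hf (integrable_const 1)
    (Real.continuous_negMulLog.comp_aestronglyMeasurable hp) h
    (h0.mono fun _ hx => negMulLog_le_one hx)

theorem IsFinEnt.mix {t : ℝ} (ht : 0 ≤ t) (ht1 : t ≤ 1) (hp : IsFinEnt ν φ u p)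
    (hq : IsFinEnt ν φ u q) : IsFinEnt ν φ u (fun x => (1 - t) * p x + t * q x) where
  toIsFeasible := hp.toIsFeasible.mix ht ht1 hq.toIsFeasible
  integrable_ent := by
    have h := hp.toIsFeasible.mix ht ht1 hq.toIsFeasible
    refine integrable_negMulLog_of_le
      ((hp.integrable_ent.const_mul (1 - t)).add (hq.integrable_ent.const_mul t))
      h.integrable.aestronglyMeasurable h.nonneg ?_
    filter_upwards [hp.nonneg, hq.nonneg] with x h1 h2
    exact negMulLog_mix_ge h1 h2 ht ht1

/-- Integrate the tangent of `negMulLog` at the uniform density `V⁻¹`; the terms `c - x` cancel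
since both densities have mass one. -/
theorem IsFinEnt.ent_le_log (hν : ν ≠ 0) (hp : IsFinEnt ν φ u p) :
    ∫ x, Real.negMulLog (p x) ∂ν ≤ Real.log (ν.real Set.univ) := by
  have : NeZero ν := ⟨hν⟩
  have hV : 0 < ν.real Set.univ := measureReal_univ_pos
  set V := ν.real Set.univ
  have hi0 : Integrable (fun x => V⁻¹ - p x) ν := (integrable_const _).sub hp.integrable
  have hi : Integrable (fun x => V⁻¹ - p x - p x * Real.log V⁻¹) ν :=
    hi0.sub (hp.integrable.mul_const _)
  calc ∫ x, Real.negMulLog (p x) ∂ν ≤ ∫ x, (V⁻¹ - p x - p x * Real.log V⁻¹) ∂ν := by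
        refine integral_mono_ae hp.integrable_ent hi ?_
        filter_upwards [hp.nonneg] with x hx
        exact negMulLog_le_tangent hx (inv_pos.2 hV)
    _ = Real.log V := by
        rw [integral_sub hi0 (hp.integrable.mul_const _), integral_sub (integrable_const _) hp.integrable,
          integral_mul_const, hp.integral_eq_one, integral_const, Real.log_inv, smul_eq_mul]
        change V * V⁻¹ - 1 - 1 * -Real.log V = Real.log V
        rw [mul_inv_cancel₀ hV.ne']
        ring

/-- The uniform density on a set where all constraints hold pointwise. -/
theorem isFinEnt_uniform {L : ℝ} (hφ : ∀ γ, AEStronglyMeasurable (φ γ) ν)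
    (hL : ∀ γ, ∀ᵐ x ∂ν, L ≤ φ γ x) {C : Set X} (hC : MeasurableSet C) (hC0 : ν C ≠ 0)
    (hCu : ∀ x ∈ C, ∀ γ, φ γ x ≤ u γ) :
    ∃ q, IsFinEnt ν φ u q ∧ ∫ x, Real.negMulLog (q x) ∂ν = Real.log (ν.real C) := by
  have hV : 0 < ν.real C := ENNReal.toReal_pos hC0 (measure_ne_top _ _)
  set V := ν.real C with hVdef
  set q : X → ℝ := C.indicator fun _ => V⁻¹ with hq
  have hqi : Integrable q ν := (integrable_const _).indicator hC
  have hq0 : ∀ x, 0 ≤ q x := fun x => Set.indicator_nonneg (fun _ _ => (inv_pos.2 hV).le) x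
  have hq1 : ∫ x, q x ∂ν = 1 := by
    rw [hq, integral_indicator_const _ hC, smul_eq_mul, mul_inv_cancel₀ hV.ne']
  have hle : ∀ γ x, φ γ x * q x ≤ u γ * q x := fun γ x => by
    by_cases hx : x ∈ C
    · exact mul_le_mul_of_nonneg_right (hCu x hx γ) (hq0 x)
    · simp [hq, hx]
  have hmul : ∀ γ, Integrable (fun x => φ γ x * q x) ν := fun γ => by
    refine integrable_of_ae_between (hqi.const_mul L) (hqi.const_mul (u γ))
      ((hφ γ).mul hqi.aestronglyMeasurable) ?_ (Eventually.of_forall (hle γ))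
    filter_upwards [hL γ] with x hx
    exact mul_le_mul_of_nonneg_right hx (hq0 x)
  have hent : (fun x => Real.negMulLog (q x)) = fun x => q x * Real.log V := by
    ext x
    by_cases hx : x ∈ C
    · simp [hq, hx, Real.negMulLog]
    · simp [hq, hx]
  refine ⟨q, ⟨⟨hqi, Eventually.of_forall hq0, hq1, hmul, fun γ => ?_⟩, ?_⟩, ?_⟩
  · calc ∫ x, φ γ x * q x ∂ν ≤ ∫ x, u γ * q x ∂ν :=
        integral_mono (hmul γ) (hqi.const_mul _) (hle γ)
      _ = u γ := by rw [integral_const_mul, hq1, mul_one]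
  · rw [hent]
    exact hqi.mul_const _
  · rw [hent, integral_mul_const, hq1, one_mul]

/-- Two densities of nearly maximal entropy are close in `L¹`. -/
theorem integral_abs_sub_le {η b : ℝ} (hη : 0 < η) (hp : IsFinEnt ν φ u p)
    (hq : IsFinEnt ν φ u q)
    (hb : ∀ r, IsFinEnt ν φ u r → ∫ x, Real.negMulLog (r x) ∂ν ≤ b) :
    ∫ x, |p x - q x| ∂ν ≤ (2 * b - ∫ x, Real.negMulLog (p x) ∂ν
      - ∫ x, Real.negMulLog (q x) ∂ν) / η + 2 * η := by
  have hm := hp.mix (t := 1 / 2) (by norm_num) (by norm_num) hq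
  have e : ∀ x, (1 - 1 / 2 : ℝ) * p x + 1 / 2 * q x = (p x + q x) / 2 := fun x => by ring
  simp_rw [e] at hm
  have hmb := hb _ hm
  have i1 : Integrable (fun x => 2 * Real.negMulLog ((p x + q x) / 2) - Real.negMulLog (p x)) ν :=
    (hm.integrable_ent.const_mul 2).sub hp.integrable_ent
  have i2 : Integrable (fun x => 2 * Real.negMulLog ((p x + q x) / 2) - Real.negMulLog (p x)
      - Real.negMulLog (q x)) ν := i1.sub hq.integrable_ent
  have i3 : Integrable (fun x => η * (p x + q x)) ν :=
    (hp.integrable.add hq.integrable).const_mul η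
  calc ∫ x, |p x - q x| ∂ν
      ≤ ∫ x, ((2 * Real.negMulLog ((p x + q x) / 2) - Real.negMulLog (p x)
          - Real.negMulLog (q x)) / η + η * (p x + q x)) ∂ν := by
        refine integral_mono_ae (hp.integrable.sub hq.integrable).abs
          ((i2.div_const η).add i3) ?_
        filter_upwards [hp.nonneg, hq.nonneg] with x h1 h2
        exact abs_sub_le_negMulLog_gap h1 h2 hη
    _ = (2 * ∫ x, Real.negMulLog ((p x + q x) / 2) ∂ν - ∫ x, Real.negMulLog (p x) ∂ν
          - ∫ x, Real.negMulLog (q x) ∂ν) / η + 2 * η := by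
        rw [integral_add (i2.div_const η) i3, integral_div,
          integral_sub i1 hq.integrable_ent,
          integral_sub (hm.integrable_ent.const_mul 2) hp.integrable_ent, integral_const_mul,
          integral_const_mul]
        have : ∫ x, (p x + q x) ∂ν = 2 := by
          rw [integral_add hp.integrable hq.integrable, hp.integral_eq_one, hq.integral_eq_one]
          norm_num
        rw [this]
        ring
    _ ≤ _ := by gcongr

/-- With both entropies maximal the gap in `integral_abs_sub_le` is zero, which leaves `2 * η` for
arbitrary `η > 0`. -/
theorem IsMaximizer.ae_eq (hp : IsMaximizer ν φ u p) (hq : IsMaximizer ν φ u q) :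
    q =ᵐ[ν] p := by
  have he := le_antisymm (hp.le q hq.toIsFinEnt) (hq.le p hp.toIsFinEnt)
  have h0 : ∫ x, |q x - p x| ∂ν = 0 := by
    refine le_antisymm (le_of_forall_pos_le_add fun ε hε => ?_)
      (integral_nonneg fun _ => abs_nonneg _)
    have := integral_abs_sub_le (half_pos hε) hq.toIsFinEnt hp.toIsFinEnt hp.le
    rw [he] at this
    refine this.trans_eq ?_
    ring
  have := (integral_eq_zero_iff_of_nonneg (fun _ => abs_nonneg _)
    (hq.integrable.sub hp.integrable).abs).1 h0
  filter_upwards [this] with x hx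
  exact sub_eq_zero.1 (abs_eq_zero.1 hx)

/-- A maximizing sequence is Cauchy in `L¹`. Along an a.e. convergent subsequence Fatou's lemma
gives both the moment bounds and upper semicontinuity of the entropy. -/
theorem exists_isMaximizer {L : ℝ} (hν : ν ≠ 0) (hφ : ∀ γ, AEStronglyMeasurable (φ γ) ν)
    (hL : ∀ γ, ∀ᵐ x ∂ν, L ≤ φ γ x) (hne : ∃ q, IsFinEnt ν φ u q) :
    ∃ p, IsMaximizer ν φ u p := by
  set A : Set ℝ := {e | ∃ q, IsFinEnt ν φ u q ∧ ∫ x, Real.negMulLog (q x) ∂ν = e} with hA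
  have hAne : A.Nonempty := let ⟨q, hq⟩ := hne; ⟨_, q, hq, rfl⟩
  have hAb : BddAbove A := ⟨Real.log (ν.real Set.univ), by
    rintro _ ⟨q, hq, rfl⟩
    exact hq.ent_le_log hν⟩
  set s := sSup A
  have hs : ∀ r, IsFinEnt ν φ u r → ∫ x, Real.negMulLog (r x) ∂ν ≤ s :=
    fun r hr => le_csSup hAb ⟨r, hr, rfl⟩
  have hex : ∀ n : ℕ, ∃ q, IsFinEnt ν φ u q ∧
      s - 1 / ((n : ℝ) + 1) < ∫ x, Real.negMulLog (q x) ∂ν := fun n => by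
    obtain ⟨_, ⟨q, hq, rfl⟩, h⟩ := exists_lt_of_lt_csSup hAne
      (sub_lt_self s (by positivity : 0 < 1 / ((n : ℝ) + 1)))
    exact ⟨q, hq, h⟩
  choose q hq hqs using hex
  set F : ℕ → (X →₁[ν] ℝ) := fun n => (hq n).integrable.toL1 (q n) with hF
  have hcau : CauchySeq F := by
    refine Metric.cauchySeq_iff.2 fun ε hε => ?_
    -- With `η = ε / 4` the term `2 * η` costs `ε / 2`. Two defects below `ε ^ 2 / 32` make the
    -- quotient by `η` less than `ε / 4`.
    obtain ⟨N, hN⟩ := exists_nat_one_div_lt (show 0 < ε ^ 2 / 32 by positivity)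
    refine ⟨N, fun m hm n hn => ?_⟩
    rw [dist_eq_norm, hF, ← Integrable.toL1_sub, L1.norm_of_fun_eq_integral_norm]
    simp only [Pi.sub_apply, Real.norm_eq_abs]
    have h1 := integral_abs_sub_le (show 0 < ε / 4 by positivity) (hq m) (hq n) hs
    have h2 : ∀ k, N ≤ k → s - ε ^ 2 / 32 < ∫ x, Real.negMulLog (q k x) ∂ν := fun k hk => by
      have : 1 / ((k : ℝ) + 1) ≤ 1 / ((N : ℝ) + 1) := by gcongr
      linarith [hqs k]
    have h3 : (2 * s - ∫ x, Real.negMulLog (q m x) ∂ν - ∫ x, Real.negMulLog (q n x) ∂ν)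
        / (ε / 4) < ε / 4 := by
      rw [div_lt_iff₀ (by positivity)]
      nlinarith [h2 m hm, h2 n hn]
    linarith
  obtain ⟨G, hG⟩ := cauchySeq_tendsto_of_complete hcau
  obtain ⟨ns, hns, hae⟩ := (tendstoInMeasure_of_tendsto_Lp hG).exists_seq_tendsto_ae
  have hlim : ∀ᵐ x ∂ν, Tendsto (fun n => q (ns n) x) atTop (𝓝 (G x)) := by
    filter_upwards [hae, ae_all_iff.2 fun n => (hq n).integrable.coeFn_toL1] with x h1 h2
    refine h1.congr fun n => ?_
    rw [hF, h2]
  have hGi : Integrable G ν := L1.integrable_coeFn G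
  have hG0 : ∀ᵐ x ∂ν, 0 ≤ G x := by
    filter_upwards [hlim, ae_all_iff.2 fun n => (hq n).nonneg] with x h1 h2
    exact ge_of_tendsto' h1 fun n => h2 _
  have hG1 : ∫ x, G x ∂ν = 1 := by
    have h1 := (continuous_integral.tendsto G).comp hG
    refine tendsto_nhds_unique h1 ?_
    refine tendsto_const_nhds.congr fun n => ?_
    simp only [Function.comp_apply, hF]
    rw [integral_congr_ae (hq n).integrable.coeFn_toL1, (hq n).integral_eq_one]
  -- Subtracting `L` makes the integrand nonnegative, as Fatou requires; the shift costs exactly `L`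
  -- because all masses are one.
  have hmom : ∀ γ, Integrable (fun x => (φ γ x - L) * G x) ν ∧
      ∫ x, (φ γ x - L) * G x ∂ν ≤ u γ - L := fun γ => by
    have e : ∀ n x, (φ γ x - L) * q (ns n) x = φ γ x * q (ns n) x - L * q (ns n) x :=
      fun n x => by ring
    refine integrable_and_integral_le_of_tendsto
      (f := fun n x => (φ γ x - L) * q (ns n) x) (c := fun _ => u γ - L)
      (fun n => ?_) (fun n => ?_) (fun n => ?_) tendsto_const_nhds
      (((hφ γ).sub aestronglyMeasurable_const).mul hGi.aestronglyMeasurable) ?_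
    · simp_rw [e]
      exact ((hq _).integrable_mul γ).sub ((hq _).integrable.const_mul L)
    · filter_upwards [hL γ, (hq (ns n)).nonneg] with x h1 h2
      exact mul_nonneg (sub_nonneg.2 h1) h2
    · simp_rw [e]
      rw [integral_sub ((hq _).integrable_mul γ) ((hq _).integrable.const_mul L),
        integral_const_mul, (hq _).integral_eq_one]
      linarith [(hq (ns n)).integral_mul_le γ]
    · filter_upwards [hlim] with x hx
      exact hx.const_mul _
  have hent : Integrable (fun x => 1 - Real.negMulLog (G x)) ν ∧
      ∫ x, (1 - Real.negMulLog (G x)) ∂ν ≤ ν.real Set.univ - s := by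
    refine integrable_and_integral_le_of_tendsto
      (f := fun n x => 1 - Real.negMulLog (q (ns n) x))
      (c := fun n => ν.real Set.univ - (s - 1 / ((ns n : ℝ) + 1)))
      (fun n => (integrable_const _).sub (hq _).integrable_ent) (fun n => ?_) (fun n => ?_) ?_
      (aestronglyMeasurable_const.sub
        (Real.continuous_negMulLog.comp_aestronglyMeasurable hGi.aestronglyMeasurable)) ?_
    · filter_upwards [(hq (ns n)).nonneg] with x hx
      exact sub_nonneg.2 (negMulLog_le_one hx)
    · rw [integral_sub (integrable_const _) (hq _).integrable_ent, integral_const, smul_eq_mul,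
        mul_one]
      linarith [hqs (ns n)]
    · have := (tendsto_one_div_add_atTop_nhds_zero_nat (𝕜 := ℝ)).comp hns.tendsto_atTop
      simpa using (this.const_sub s).const_sub (ν.real Set.univ)
    · filter_upwards [hlim] with x hx
      exact ((Real.continuous_negMulLog.tendsto _).comp hx).const_sub 1
  have hGent : Integrable (fun x => Real.negMulLog (G x)) ν := by
    refine ((integrable_const (1 : ℝ)).sub hent.1).congr (Eventually.of_forall fun x => ?_)
    simp
  have hmul : ∀ γ, Integrable (fun x => φ γ x * G x) ν := fun γ => by
    refine ((hmom γ).1.add (hGi.const_mul L)).congr (Eventually.of_forall fun x => ?_)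
    simp only [Pi.add_apply]
    ring
  refine ⟨G, ⟨⟨⟨hGi, hG0, hG1, hmul, fun γ => ?_⟩, hGent⟩, fun r hr => (hs r hr).trans ?_⟩⟩
  · have h := (hmom γ).2
    simp_rw [sub_mul] at h
    rw [integral_sub (hmul γ) (hGi.const_mul L), integral_const_mul, hG1] at h
    linarith
  · have h := hent.2
    rw [integral_sub (integrable_const _) hGent, integral_const, smul_eq_mul, mul_one] at h
    linarith

end FiniteMeasure

/-! ### Optimality conditions: support and multipliers -/

theorem integrable_simpleFunc_mul {w : X → ℝ} (hw : Integrable w ν) (g : SimpleFunc X ℝ) :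
    Integrable (fun x => g x * w x) ν :=
  let ⟨_, hM⟩ := g.exists_forall_norm_le
  hw.bdd_mul g.aestronglyMeasurable (Eventually.of_forall hM)

/-- Integration of simple functions against an integrable weight, as a linear functional. -/
noncomputable def simpleIntegral {w : X → ℝ} (hw : Integrable w ν) : SimpleFunc X ℝ →ₗ[ℝ] ℝ where
  toFun g := ∫ x, g x * w x ∂ν
  map_add' g k := by
    rw [← integral_add (integrable_simpleFunc_mul hw g) (integrable_simpleFunc_mul hw k)]
    simp only [SimpleFunc.coe_add, Pi.add_apply, add_mul]
  map_smul' c g := by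
    rw [RingHom.id_apply, smul_eq_mul, ← integral_const_mul]
    simp only [SimpleFunc.coe_smul, Pi.smul_apply, smul_eq_mul, mul_assoc]

theorem simpleIntegral_apply {w : X → ℝ} (hw : Integrable w ν) (g : SimpleFunc X ℝ) :
    simpleIntegral hw g = ∫ x, g x * w x ∂ν := rfl

section Maximizer

variable [IsFiniteMeasure ν] {φ : Γ → X → ℝ} {u : Γ → ℝ} {p q : X → ℝ}

/-- Every feasible density of finite entropy vanishes where the maximizer does. -/
theorem IsMaximizer.ae_eq_zero_of_eq_zero (hp : IsMaximizer ν φ u p) (hq : IsFinEnt ν φ u q) :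
    ∀ᵐ x ∂ν, p x = 0 → q x = 0 := by
  set N : Set X := p ⁻¹' {0} with hN
  have hNm : NullMeasurableSet N ν :=
    hp.integrable.aemeasurable.nullMeasurable (measurableSet_singleton 0)
  have hI : Integrable (N.indicator q) ν := hq.integrable.indicator₀ hNm
  have hI0 : ∀ᵐ x ∂ν, 0 ≤ N.indicator q x := by
    filter_upwards [hq.nonneg] with x hx
    exact Set.indicator_apply_nonneg fun _ => hx
  set D := ∫ x, Real.negMulLog (p x) ∂ν - ∫ x, Real.negMulLog (q x) ∂ν with hD
  have hD0 : 0 ≤ D := sub_nonneg.2 (hp.le q hq)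
  have key : ∀ K : ℝ, 0 < K → K * ∫ x, N.indicator q x ∂ν ≤ D := fun K hK => by
    -- Where `p = 0`, mixing in a fraction `t` of `q` gains the extra entropy `-t log t · q = t K
    -- q`, while elsewhere concavity loses at most order `t`. Dividing by `t` leaves a bound by `D`
    -- independent of `K`.
    set t := Real.exp (-K) with ht
    have ht0 : 0 < t := Real.exp_pos _
    have ht1 : t ≤ 1 := Real.exp_le_one_iff.2 (by linarith)
    have hm := hp.toIsFinEnt.mix ht0.le ht1 hq
    have i1 : Integrable (fun x => (1 - t) * Real.negMulLog (p x) + t * Real.negMulLog (q x)) ν :=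
      (hp.integrable_ent.const_mul _).add (hq.integrable_ent.const_mul _)
    have h1 : ∫ x, ((1 - t) * Real.negMulLog (p x) + t * Real.negMulLog (q x)
        + (t * K) * N.indicator q x) ∂ν ≤ ∫ x, Real.negMulLog (p x) ∂ν := by
      refine le_trans (integral_mono_ae (i1.add (hI.const_mul _)) hm.integrable_ent ?_)
        (hp.le _ hm)
      filter_upwards [hp.nonneg, hq.nonneg] with x h1 h2
      by_cases hx : p x = 0
      · have hxN : x ∈ N := hx
        simp only [hx, Set.indicator_of_mem hxN, Real.negMulLog_zero, mul_zero, zero_add,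
          Real.negMulLog_mul]
        have : Real.negMulLog t = t * K := by
          rw [Real.negMulLog, ht, Real.log_exp]
          ring
        rw [this]
        linarith
      · have hxN : x ∉ N := hx
        simp only [Set.indicator_of_notMem hxN, mul_zero, add_zero]
        exact negMulLog_mix_ge h1 h2 ht0.le ht1
    rw [integral_add i1 (hI.const_mul _), integral_add (hp.integrable_ent.const_mul _)
      (hq.integrable_ent.const_mul _), integral_const_mul, integral_const_mul,
      integral_const_mul] at h1
    have h2 : t * (K * ∫ x, N.indicator q x ∂ν) ≤ t * D := by
      rw [hD]
      linarith
    exact le_of_mul_le_mul_left h2 ht0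
  have hQ : ∫ x, N.indicator q x ∂ν = 0 := by
    refine le_antisymm ?_ (integral_nonneg_of_ae hI0)
    by_contra! hc
    have := key ((D + 1) / ∫ x, N.indicator q x ∂ν) (by positivity)
    rw [div_mul_cancel₀ _ hc.ne'] at this
    linarith
  filter_upwards [(integral_eq_zero_iff_of_nonneg_ae hI0 hI).1 hQ] with x hx hpx
  rwa [Set.indicator_of_mem (show x ∈ N from hpx)] at hx

/-- First-order optimality of a maximizer, tested against bounded multiplicative perturbations
that do not increase the active moments. -/
theorem IsMaximizer.integral_mul_ent_le [Finite Γ] (hp : IsMaximizer ν φ u p) {g : X → ℝ} {M : ℝ}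
    (hg : AEStronglyMeasurable g ν) (hM : ∀ x, |g x| ≤ M) (hg0 : ∫ x, g x * p x ∂ν = 0)
    (hact : ∀ γ, ∫ x, φ γ x * p x ∂ν = u γ → ∫ x, g x * (φ γ x * p x) ∂ν ≤ 0) :
    ∫ x, g x * Real.negMulLog (p x) ∂ν ≤ 0 := by
  have hgM : ∀ᵐ x ∂ν, ‖g x‖ ≤ M := Eventually.of_forall hM
  have igp : Integrable (fun x => g x * p x) ν := hp.integrable.bdd_mul hg hgM
  have iggp : Integrable (fun x => g x * (g x * p x)) ν := igp.bdd_mul hg hgM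
  have igφ : ∀ γ, Integrable (fun x => g x * (φ γ x * p x)) ν :=
    fun γ => (hp.integrable_mul γ).bdd_mul hg hgM
  have ige : Integrable (fun x => g x * Real.negMulLog (p x)) ν :=
    hp.integrable_ent.bdd_mul hg hgM
  have e1 : ∀ᶠ ε : ℝ in 𝓝[>] 0, ε * M ≤ 1 := by
    have : Tendsto (fun ε : ℝ => ε * M) (𝓝[>] 0) (𝓝 0) := by
      have hc : Continuous fun ε : ℝ => ε * M := by fun_prop
      simpa using (hc.tendsto 0).mono_left nhdsWithin_le_nhds
    exact this.eventually (eventually_le_nhds one_pos)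
  -- Inactive constraints have slack that absorbs a small `ε`; active ones are preserved by the sign
  -- condition `hact`, since moments are affine in `ε`.
  have e2 : ∀ᶠ ε : ℝ in 𝓝[>] 0, ∀ γ,
      ∫ x, φ γ x * p x ∂ν + ε * ∫ x, g x * (φ γ x * p x) ∂ν ≤ u γ := by
    refine eventually_all.2 fun γ => ?_
    rcases (hp.integral_mul_le γ).eq_or_lt with h | h
    · filter_upwards [self_mem_nhdsWithin] with ε hε
      have := mul_nonpos_of_nonneg_of_nonpos (le_of_lt (Set.mem_Ioi.1 hε)) (hact γ h)
      linarith
    · have : Tendsto (fun ε : ℝ => ∫ x, φ γ x * p x ∂ν + ε * ∫ x, g x * (φ γ x * p x) ∂ν)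
          (𝓝[>] 0) (𝓝 (∫ x, φ γ x * p x ∂ν)) := by
        have hc : Continuous fun ε : ℝ =>
            ∫ x, φ γ x * p x ∂ν + ε * ∫ x, g x * (φ γ x * p x) ∂ν := by fun_prop
        simpa using (hc.tendsto 0).mono_left nhdsWithin_le_nhds
      exact this.eventually (eventually_le_nhds h)
  -- The first-order term of the perturbed factor integrates to zero by `hg0`, so only an error
  -- quadratic in `ε` remains; dividing by `ε` leaves the factor `ε` on the right.
  have e3 : ∀ᶠ ε : ℝ in 𝓝[>] 0,
      ∫ x, g x * Real.negMulLog (p x) ∂ν ≤ ε * ∫ x, g x * (g x * p x) ∂ν := by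
    filter_upwards [e1, e2, self_mem_nhdsWithin] with ε h1 h2 hε
    have hε : 0 < ε := hε
    have hpos : ∀ x, 0 ≤ 1 + ε * g x := fun x => by
      have := mul_le_mul_of_nonneg_left (hM x) hε.le
      have h3 := mul_le_mul_of_nonneg_left (neg_abs_le (g x)) hε.le
      linarith
    have hfeas : IsFeasible ν φ u (fun x => (1 + ε * g x) * p x) := by
      have r1 : ∀ x, (1 + ε * g x) * p x = p x + ε * (g x * p x) := fun x => by ring
      have r2 : ∀ γ x, φ γ x * ((1 + ε * g x) * p x)
          = φ γ x * p x + ε * (g x * (φ γ x * p x)) := fun γ x => by ring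
      refine ⟨?_, ?_, ?_, fun γ => ?_, fun γ => ?_⟩
      · simp_rw [r1]
        exact hp.integrable.add (igp.const_mul ε)
      · filter_upwards [hp.nonneg] with x hx
        exact mul_nonneg (hpos x) hx
      · simp_rw [r1]
        rw [integral_add hp.integrable (igp.const_mul ε), integral_const_mul, hg0,
          hp.integral_eq_one]
        ring
      · simp_rw [r2]
        exact (hp.integrable_mul γ).add ((igφ γ).const_mul ε)
      · simp_rw [r2]
        rw [integral_add (hp.integrable_mul γ) ((igφ γ).const_mul ε), integral_const_mul]
        exact h2 γ
    have i1 : Integrable (fun x => Real.negMulLog (p x) + ε * (g x * Real.negMulLog (p x))) ν :=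
      hp.integrable_ent.add (ige.const_mul ε)
    have i2 : Integrable (fun x => ε * (g x * p x) + ε ^ 2 * (g x * (g x * p x))) ν :=
      (igp.const_mul ε).add (iggp.const_mul _)
    have hle : ∀ᵐ x ∂ν, Real.negMulLog (p x) + ε * (g x * Real.negMulLog (p x))
        - (ε * (g x * p x) + ε ^ 2 * (g x * (g x * p x)))
          ≤ Real.negMulLog ((1 + ε * g x) * p x) := by
      filter_upwards [hp.nonneg] with x hx
      refine le_trans (le_of_eq ?_) (negMulLog_perturb_ge hx (hpos x))
      ring
    have hfin : IsFinEnt ν φ u (fun x => (1 + ε * g x) * p x) :=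
      ⟨hfeas, integrable_negMulLog_of_le (i1.sub i2) hfeas.integrable.aestronglyMeasurable
        hfeas.nonneg hle⟩
    have h4 := (integral_mono_ae (i1.sub i2) hfin.integrable_ent hle).trans (hp.le _ hfin)
    simp only [Pi.sub_apply] at h4
    rw [integral_sub i1 i2, integral_add hp.integrable_ent (ige.const_mul ε),
      integral_add (igp.const_mul ε) (iggp.const_mul _), integral_const_mul, integral_const_mul,
      integral_const_mul, hg0] at h4
    refine le_of_mul_le_mul_left ?_ hε
    linarith
  have lim : Tendsto (fun ε : ℝ => ε * ∫ x, g x * (g x * p x) ∂ν) (𝓝[>] 0) (𝓝 0) := by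
    have hc : Continuous fun ε : ℝ => ε * ∫ x, g x * (g x * p x) ∂ν := by fun_prop
    simpa using (hc.tendsto 0).mono_left nhdsWithin_le_nhds
  exact ge_of_tendsto lim e3

/-- The maximizer has exponential form on its support, with multipliers satisfying
complementary slackness. -/
theorem IsMaximizer.exists_multipliers [Fintype Γ] (hp : IsMaximizer ν φ u p) :
    ∃ lam : Γ → ℝ, (∀ γ, 0 ≤ lam γ) ∧ (∀ γ, lam γ * (∫ x, φ γ x * p x ∂ν - u γ) = 0) ∧
      ∀ᵐ x ∂ν, p x ≠ 0 → Real.log (p x) = -(∫ x, Real.negMulLog (p x) ∂ν)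
        - ∑ γ, lam γ * (φ γ x - ∫ x, φ γ x * p x ∂ν) := by
  classical
  set m : Γ → ℝ := fun γ => ∫ x, φ γ x * p x ∂ν with hm
  set h : ℝ := ∫ x, Real.negMulLog (p x) ∂ν with hh
  have iw : ∀ γ, Integrable (fun x => φ γ x * p x - m γ * p x) ν :=
    fun γ => (hp.integrable_mul γ).sub (hp.integrable.const_mul _)
  have ie : Integrable (fun x => Real.negMulLog (p x) - h * p x) ν :=
    hp.integrable_ent.sub (hp.integrable.const_mul _)
  -- An admissible `g` must have mean zero under `p`. Moving the centering from `g` to the weight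
  -- removes this side condition, so Farkas' lemma can be used on all simple functions.
  have center : ∀ (w : X → ℝ) (hw : Integrable w ν) (g : SimpleFunc X ℝ),
      ∫ x, (g x - ∫ y, g y * p y ∂ν) * w x ∂ν
        = ∫ x, g x * (w x - (∫ y, w y ∂ν) * p x) ∂ν := fun w hw g => by
    have r1 : ∀ x, (g x - ∫ y, g y * p y ∂ν) * w x
        = g x * w x - (∫ y, g y * p y ∂ν) * w x := fun x => by ring
    have r2 : ∀ x, g x * (w x - (∫ y, w y ∂ν) * p x)
        = g x * w x - (∫ y, w y ∂ν) * (g x * p x) := fun x => by ring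
    simp_rw [r1, r2]
    rw [integral_sub (integrable_simpleFunc_mul hw g) (hw.const_mul _),
      integral_sub (integrable_simpleFunc_mul hw g)
        ((integrable_simpleFunc_mul hp.integrable g).const_mul _), integral_const_mul,
      integral_const_mul]
    ring
  -- Only active constraints enter Farkas' lemma. The others get multiplier 0, which is
  -- complementary slackness.
  set s : Finset Γ := Finset.univ.filter fun γ => m γ = u γ with hs
  obtain ⟨lam, hlam, hsum⟩ := farkas_functionals s (fun γ => simpleIntegral (iw γ))
    (simpleIntegral ie) fun g hg => by
      obtain ⟨M, hM⟩ := g.exists_forall_norm_le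
      rw [simpleIntegral_apply, ← center _ hp.integrable_ent]
      refine hp.integral_mul_ent_le (M := M + |∫ y, g y * p y ∂ν|)
        (g.aestronglyMeasurable.sub aestronglyMeasurable_const) (fun x => ?_) ?_ fun γ hγ => ?_
      · exact (abs_sub _ _).trans (by gcongr; exact hM x)
      · rw [center _ hp.integrable, hp.integral_eq_one]
        simp
      · rw [center _ (hp.integrable_mul γ)]
        exact hg γ (by simpa [hs] using hγ)
  set lam' : Γ → ℝ := fun γ => if m γ = u γ then lam γ else 0 with hlam'
  have hsum' : ∀ g : SimpleFunc X ℝ, ∫ x, g x * (Real.negMulLog (p x) - h * p x) ∂ν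
      = ∑ γ, lam' γ * ∫ x, g x * (φ γ x * p x - m γ * p x) ∂ν := fun g => by
    have h1 := hsum g
    simp only [simpleIntegral_apply] at h1
    rw [h1, hs, Finset.sum_filter]
    exact Finset.sum_congr rfl fun γ _ => by simp only [hlam', ite_mul, zero_mul]
  refine ⟨lam', fun γ => ?_, fun γ => ?_, ?_⟩
  · simp only [hlam']
    split_ifs
    exacts [hlam γ, le_rfl]
  · simp only [hlam']
    split_ifs with hγ
    · rw [show ∫ x, φ γ x * p x ∂ν = u γ from hγ, sub_self, mul_zero]
    · rw [zero_mul]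
  · have is : Integrable (fun x => ∑ γ, lam' γ * (φ γ x * p x - m γ * p x)) ν :=
      integrable_finsetSum _ fun γ _ => (iw γ).const_mul _
    -- The identity of functionals, tested on indicators of measurable sets, becomes an a.e.
    -- identity of weights; it is divided by `p x` below.
    have hz := (ie.sub is).ae_eq_zero_of_forall_setIntegral_eq_zero fun A hA _ => by
      have h1 := hsum' ((SimpleFunc.const X (1 : ℝ)).restrict A)
      have r : ∀ w : X → ℝ, ∫ x, ((SimpleFunc.const X (1 : ℝ)).restrict A) x * w x ∂ν
          = ∫ x in A, w x ∂ν := fun w => by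
        rw [← integral_indicator hA]
        refine integral_congr_ae (Eventually.of_forall fun x => ?_)
        by_cases hx : x ∈ A <;> simp [SimpleFunc.restrict_apply _ hA, hx]
      simp only [r] at h1
      simp only [Pi.sub_apply]
      rw [integral_sub ie.integrableOn is.integrableOn, h1,
        integral_finsetSum _ fun γ _ => ((iw γ).const_mul _).integrableOn]
      simp only [integral_const_mul, sub_self]
    filter_upwards [hz] with x hx hpx
    simp only [Pi.sub_apply, Pi.zero_apply] at hx
    have r : ∑ γ, lam' γ * (φ γ x * p x - m γ * p x)
        = (∑ γ, lam' γ * (φ γ x - m γ)) * p x := by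
      rw [Finset.sum_mul]
      exact Finset.sum_congr rfl fun γ _ => by ring
    rw [r, Real.negMulLog] at hx
    have h2 : p x * (Real.log (p x) + h + ∑ γ, lam' γ * (φ γ x - m γ)) = 0 := by linarith
    rcases mul_eq_zero.1 h2 with h3 | h3
    · exact absurd h3 hpx
    · linarith

end Maximizer

end Core

theorem IsMaximizer.congr_ae {X Γ : Type*} [MeasurableSpace X] {ν : Measure X} {φ : Γ → X → ℝ}
    {u : Γ → ℝ} {p q : X → ℝ} (hp : IsMaximizer ν φ u p) (h : p =ᵐ[ν] q) :
    IsMaximizer ν φ u q := by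
  have hmul : ∀ γ, (fun x => φ γ x * p x) =ᵐ[ν] fun x => φ γ x * q x := fun γ => by
    filter_upwards [h] with x hx
    rw [hx]
  have hent : (fun x => Real.negMulLog (p x)) =ᵐ[ν] fun x => Real.negMulLog (q x) := by
    filter_upwards [h] with x hx
    rw [hx]
  refine ⟨⟨⟨hp.integrable.congr h, ?_, ?_, fun γ => (hp.integrable_mul γ).congr (hmul γ),
    fun γ => ?_⟩, hp.integrable_ent.congr hent⟩, fun r hr => ?_⟩
  · filter_upwards [h, hp.nonneg] with x hx h0
    rwa [← hx]
  · rw [← integral_congr_ae h, hp.integral_eq_one]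
  · rw [← integral_congr_ae (hmul γ)]
    exact hp.integral_mul_le γ
  · rw [← integral_congr_ae hent]
    exact hp.le r hr

/-! ### From extended-real integrals over space to real integrals over `S` -/

section Bridge

variable {d : ℕ} {Γ : Type*} {S : Set (EuclideanSpace ℝ (Fin d))}
  {φ : Γ → EuclideanSpace ℝ (Fin d) → ℝ} {u : Γ → ℝ} {f p q : EuclideanSpace ℝ (Fin d) → ℝ}

theorem lintegral_ofReal_ne_top (hf : Integrable f) : (∫⁻ x, ENNReal.ofReal (f x)) ≠ ⊤ :=
  ((lintegral_mono fun x => Real.ofReal_le_enorm (f x)).trans_lt hf.hasFiniteIntegral).ne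

theorem extIntegral_of_integrable (hf : Integrable f) : extIntegral f = ((∫ x, f x : ℝ) : EReal) := by
  rw [extIntegral, integral_eq_lintegral_pos_part_sub_lintegral_neg_part hf, EReal.coe_sub,
    EReal.coe_ennreal_toReal (lintegral_ofReal_ne_top hf),
    EReal.coe_ennreal_toReal (lintegral_ofReal_ne_top (f := fun x => -f x) hf.neg)]

theorem integrable_of_extIntegral_ne_top (hf : AEMeasurable f)
    (hneg : (∫⁻ x, ENNReal.ofReal (-f x)) ≠ ⊤) (h : extIntegral f ≠ ⊤) : Integrable f := by
  have hpos : (∫⁻ x, ENNReal.ofReal (f x)) ≠ ⊤ := fun hc => by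
    refine h ?_
    rw [extIntegral, hc, EReal.coe_ennreal_top, ← EReal.coe_ennreal_toReal hneg]
    exact EReal.top_sub_coe _
  refine ⟨hf.aestronglyMeasurable, ?_⟩
  have hle : ∫⁻ x, ‖f x‖ₑ ≤ (∫⁻ x, ENNReal.ofReal (f x)) + ∫⁻ x, ENNReal.ofReal (-f x) := by
    rw [← lintegral_add_left' hf.ennreal_ofReal]
    refine lintegral_mono fun x => ?_
    rw [Real.enorm_eq_ofReal_abs]
    rcases le_total 0 (f x) with h0 | h0
    · rw [abs_of_nonneg h0]
      exact le_self_add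
    · rw [abs_of_nonpos h0]
      exact le_add_self
  exact hle.trans_lt (ENNReal.add_lt_top.2 ⟨hpos.lt_top, hneg.lt_top⟩)

theorem ae_eq_zero_of_mem_momentClass (hq : q ∈ momentClass S φ u) : ∀ᵐ x, x ∉ S → q x = 0 := by
  refine measure_mono_null (fun x hx => ?_) hq.2.1
  simp only [Set.mem_compl_iff, Set.mem_ofPred_eq, Classical.not_imp] at hx
  exact ⟨hx.2, hx.1⟩

theorem IsPdf.integrable (hq : IsPdf q) : Integrable q :=
  (lintegral_ofReal_ne_top_iff_integrable hq.aemeasurable.aestronglyMeasurable hq.nonneg).1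
    (by rw [hq.lintegral_eq_one]; exact ENNReal.one_ne_top)

theorem IsPdf.integral_eq_one (hq : IsPdf q) : ∫ x, q x = 1 := by
  rw [integral_eq_lintegral_of_nonneg_ae hq.nonneg hq.aemeasurable.aestronglyMeasurable,
    hq.lintegral_eq_one, ENNReal.toReal_one]

/-- The bound `φ γ ≥ L` controls the negative part of `φ γ * q` by `-L * q`, and the moment bound `u
γ` excludes an infinite positive part. -/
theorem isFeasible_of_mem_momentClass {L : ℝ} (hφ : ∀ γ, AEMeasurable (φ γ) volume)
    (hL : ∀ γ, ∀ᵐ x, L ≤ φ γ x) (hq : q ∈ momentClass S φ u) :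
    IsFeasible (volume.restrict S) φ u q := by
  have hz := ae_eq_zero_of_mem_momentClass hq
  have hi := hq.1.integrable
  have hz' : ∀ γ, ∀ᵐ x, x ∉ S → φ γ x * q x = 0 := fun γ => by
    filter_upwards [hz] with x hx hxS
    rw [hx hxS, mul_zero]
  have hmul : ∀ γ, Integrable (fun x => φ γ x * q x) := fun γ => by
    refine integrable_of_extIntegral_ne_top ((hφ γ).mul hq.1.aemeasurable) ?_
      ((hq.2.2 γ).2.trans_lt (EReal.coe_lt_top _)).ne
    refine ((lintegral_mono_ae ?_).trans_lt (lintegral_ofReal_ne_top (hi.const_mul (-L))).lt_top).ne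
    filter_upwards [hL γ, hq.1.nonneg] with x h1 h2
    refine ENNReal.ofReal_le_ofReal ?_
    nlinarith
  refine ⟨hi.integrableOn, ae_restrict_of_ae hq.1.nonneg, ?_, fun γ => (hmul γ).integrableOn,
    fun γ => ?_⟩
  · rw [setIntegral_eq_integral_of_ae_compl_eq_zero hz, hq.1.integral_eq_one]
  · rw [setIntegral_eq_integral_of_ae_compl_eq_zero (hz' γ)]
    have := (hq.2.2 γ).2
    rw [expectation, extIntegral_of_integrable (hmul γ)] at this
    exact EReal.coe_le_coe_iff.1 this

theorem IsFeasible.integrable_moment (hp : IsFeasible (volume.restrict S) φ u p)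
    (hz : ∀ᵐ x, x ∉ S → p x = 0) (γ : Γ) : Integrable (fun x => φ γ x * p x) := by
  refine IntegrableOn.integrable_of_ae_notMem_eq_zero (hp.integrable_mul γ) ?_
  filter_upwards [hz] with x hx hxS
  rw [hx hxS, mul_zero]

theorem IsFeasible.expectation_eq (hp : IsFeasible (volume.restrict S) φ u p)
    (hz : ∀ᵐ x, x ∉ S → p x = 0) (γ : Γ) :
    expectation p (φ γ) = ((∫ x in S, φ γ x * p x : ℝ) : EReal) := by
  rw [expectation, extIntegral_of_integrable (hp.integrable_moment hz γ),
    setIntegral_eq_integral_of_ae_compl_eq_zero]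
  filter_upwards [hz] with x hx hxS
  rw [hx hxS, mul_zero]

theorem IsFeasible.mem_momentClass (hS : MeasurableSet S)
    (hp : IsFeasible (volume.restrict S) φ u p)
    (hz : ∀ᵐ x, x ∉ S → p x = 0) : p ∈ momentClass S φ u := by
  have hi : Integrable p := IntegrableOn.integrable_of_ae_notMem_eq_zero hp.integrable hz
  have h0 : ∀ᵐ x, 0 ≤ p x := by
    filter_upwards [hz, (ae_restrict_iff' hS).1 hp.nonneg] with x h1 h2
    by_cases hx : x ∈ S
    exacts [h2 hx, (h1 hx).ge]
  refine ⟨⟨hi.aemeasurable, h0, ?_⟩, ?_, fun γ => ⟨?_, ?_⟩⟩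
  · rw [← ofReal_integral_eq_lintegral_ofReal hi h0,
      ← setIntegral_eq_integral_of_ae_compl_eq_zero hz, hp.integral_eq_one, ENNReal.ofReal_one]
  · refine measure_mono_null (fun x hx => ?_) (ae_iff.1 hz)
    simp only [Set.mem_ofPred_eq, Classical.not_imp]
    exact ⟨hx.2, hx.1⟩
  · exact Or.inl (lintegral_ofReal_ne_top (hp.integrable_moment hz γ))
  · rw [hp.expectation_eq hz γ]
    exact EReal.coe_le_coe_iff.2 (hp.integral_mul_le γ)

/-- The integrand is at most 1 on `S` and vanishes a.e. off it. Hence entropy can fail to be finite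
only by being `⊥`. -/
theorem lintegral_negMulLog_ne_top (hSfin : volume S ≠ ⊤) (h0 : ∀ᵐ x, 0 ≤ q x)
    (hz : ∀ᵐ x, x ∉ S → q x = 0) :
    (∫⁻ x, ENNReal.ofReal (-(Real.log (q x) * q x))) ≠ ⊤ := by
  refine ((lintegral_mono_ae (g := S.indicator fun _ => 1) ?_).trans_lt
    ((lintegral_indicator_const_le S 1).trans_lt ?_)).ne
  · filter_upwards [h0, hz] with x h1 h2
    by_cases hx : x ∈ S
    · rw [Set.indicator_of_mem hx, ENNReal.ofReal_le_one]
      refine le_of_eq_of_le ?_ (negMulLog_le_one h1)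
      rw [Real.negMulLog]
      ring
    · simp [h2 hx]
  · rw [one_mul]
    exact hSfin.lt_top

theorem entropyDefined_of_mem_momentClass (hSfin : volume S ≠ ⊤) (hq : q ∈ momentClass S φ u) :
    EntropyDefined q :=
  Or.inr (lintegral_negMulLog_ne_top hSfin hq.1.nonneg (ae_eq_zero_of_mem_momentClass hq))

theorem isFinEnt_of_mem_momentClass {L : ℝ} (hSfin : volume S ≠ ⊤)
    (hφ : ∀ γ, AEMeasurable (φ γ) volume)
    (hL : ∀ γ, ∀ᵐ x, L ≤ φ γ x) (hq : q ∈ momentClass S φ u) (h : ⊥ < entropy q) :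
    IsFinEnt (volume.restrict S) φ u q := by
  refine ⟨isFeasible_of_mem_momentClass hφ hL hq, ?_⟩
  have hi : Integrable (fun x => Real.log (q x) * q x) := by
    refine integrable_of_extIntegral_ne_top
      ((Real.measurable_log.comp_aemeasurable hq.1.aemeasurable).mul hq.1.aemeasurable)
      (lintegral_negMulLog_ne_top hSfin hq.1.nonneg (ae_eq_zero_of_mem_momentClass hq)) ?_
    intro hc
    rw [entropy, expectation, hc] at h
    simp at h
  refine (hi.integrableOn.neg).congr (Eventually.of_forall fun x => ?_)
  simp only [Pi.neg_apply, Real.negMulLog]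
  ring

theorem IsFinEnt.entropy_eq (hp : IsFinEnt (volume.restrict S) φ u p)
    (hz : ∀ᵐ x, x ∉ S → p x = 0) :
    entropy p = ((∫ x in S, Real.negMulLog (p x) : ℝ) : EReal) := by
  have hz' : ∀ᵐ x, x ∉ S → Real.negMulLog (p x) = 0 := by
    filter_upwards [hz] with x hx hxS
    rw [hx hxS, Real.negMulLog_zero]
  have hi : Integrable (fun x => Real.negMulLog (p x)) :=
    IntegrableOn.integrable_of_ae_notMem_eq_zero hp.integrable_ent hz'
  have e : (fun x => Real.log (p x) * p x) = fun x => -Real.negMulLog (p x) := by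
    ext x
    rw [Real.negMulLog]
    ring
  rw [entropy, expectation, e, extIntegral_of_integrable (f := fun x => -Real.negMulLog (p x)) hi.neg,
    ← EReal.coe_neg, integral_neg,
    neg_neg, setIntegral_eq_integral_of_ae_compl_eq_zero hz']

/-- The core maximizer, extended by zero, maximizes the entropy over the moment class. -/
theorem IsMaximizer.isMaxEnt {L : ℝ} (hS : MeasurableSet S) (hSfin : volume S ≠ ⊤)
    (hφ : ∀ γ, AEMeasurable (φ γ) volume) (hL : ∀ γ, ∀ᵐ x, L ≤ φ γ x)
    (hp : IsMaximizer (volume.restrict S) φ u p) (hz : ∀ᵐ x, x ∉ S → p x = 0) :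
    IsMaxEnt (momentClass S φ u) p := by
  refine ⟨hp.toIsFeasible.mem_momentClass hS hz,
    fun q hq => ⟨entropyDefined_of_mem_momentClass hSfin hq, ?_⟩⟩
  rcases eq_or_ne (entropy q) ⊥ with h | h
  · rw [h]
    exact bot_le
  · have hqf := isFinEnt_of_mem_momentClass hSfin hφ hL hq (bot_lt_iff_ne_bot.2 h)
    rw [hp.toIsFinEnt.entropy_eq hz, hqf.entropy_eq (ae_eq_zero_of_mem_momentClass hq)]
    exact EReal.coe_le_coe_iff.2 (hp.le q hqf)

/-- Comparison with `p` forces `q` to have finite entropy, so `q` is a maximizer on `S` too and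
uniqueness there applies. -/
theorem IsMaxEnt.ae_eq {L : ℝ} (hS : MeasurableSet S) (hSfin : volume S ≠ ⊤)
    (hφ : ∀ γ, AEMeasurable (φ γ) volume) (hL : ∀ γ, ∀ᵐ x, L ≤ φ γ x)
    (hp : IsMaximizer (volume.restrict S) φ u p) (hz : ∀ᵐ x, x ∉ S → p x = 0)
    (hq : IsMaxEnt (momentClass S φ u) q) : q =ᵐ[volume] p := by
  have : IsFiniteMeasure (volume.restrict S) := ⟨by simpa using hSfin.lt_top⟩
  have hzq := ae_eq_zero_of_mem_momentClass hq.1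
  have hle := (hq.2 p (hp.toIsFeasible.mem_momentClass hS hz)).2
  have hpe := hp.toIsFinEnt.entropy_eq hz
  rw [hpe] at hle
  have hqf := isFinEnt_of_mem_momentClass hSfin hφ hL hq.1 ((EReal.bot_lt_coe _).trans_le hle)
  rw [hqf.entropy_eq hzq, EReal.coe_le_coe_iff] at hle
  have hqm : IsMaximizer (volume.restrict S) φ u q := ⟨hqf, fun r hr => (hp.le r hr).trans hle⟩
  filter_upwards [hz, hzq, (ae_restrict_iff' hS).1 (hp.ae_eq hqm)] with x h1 h2 h3
  by_cases hx : x ∈ S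
  · exact h3 hx
  · rw [h1 hx, h2 hx]

/-- The `φ γ` are only a.e. measurable, so the feasible set is only null measurable. The uniform
density needs a measurable subset of full measure on which the constraints still hold pointwise. -/
theorem exists_measurableSet_feasible [Finite Γ] (hS : MeasurableSet S)
    (hφ : ∀ γ, AEMeasurable (φ γ) volume) :
    ∃ C ⊆ feasibleSet S φ u, MeasurableSet C ∧ volume C = volume (feasibleSet S φ u) := by
  have : feasibleSet S φ u = S ∩ ⋂ γ, {x | φ γ x ≤ u γ} := by
    ext x
    simp [feasibleSet]
  have hn : NullMeasurableSet (feasibleSet S φ u) volume := by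
    rw [this]
    exact hS.nullMeasurableSet.inter
      (NullMeasurableSet.iInter fun γ => nullMeasurableSet_le (hφ γ) aemeasurable_const)
  obtain ⟨C, h1, h2, h3⟩ := hn.exists_measurable_subset_ae_eq
  exact ⟨C, h1, h2, measure_congr h3⟩

end Bridge

end MaxEnt

/-! ### Assembly of the main theorem -/

theorem mainTheorem6 {d : ℕ} {Γ : Type*} [Fintype Γ]
    (S : Set (EuclideanSpace ℝ (Fin d))) (hS : IsClosed S)
    (hS0 : volume S ≠ 0) (hSfin : volume S ≠ ⊤)
    (φ : Γ → EuclideanSpace ℝ (Fin d) → ℝ) (hφ : ∀ γ, AEMeasurable (φ γ) volume)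
    (L : ℝ) (hL : ∀ γ, ∀ᵐ x, L ≤ φ γ x)
    (u : Γ → ℝ)
    (hΩ : (MaxEnt.momentClass S φ u).Nonempty)
    (hC : volume (MaxEnt.feasibleSet S φ u) ≠ 0) :
    ∃ p : EuclideanSpace ℝ (Fin d) → ℝ,
      -- `p` is a maxent pdf, and it is the only one up to null sets
      MaxEnt.IsMaxEnt (MaxEnt.momentClass S φ u) p ∧
      (∀ q, MaxEnt.IsMaxEnt (MaxEnt.momentClass S φ u) q → q =ᵐ[volume] p) ∧
      -- its entropy is finite, between `ln |C|` and `ln |S|`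
      ∃ h : ℝ, MaxEnt.entropy p = (h : EReal) ∧
        Real.log (volume (MaxEnt.feasibleSet S φ u)).toReal ≤ h ∧
        h ≤ Real.log (volume S).toReal ∧
        -- its support lies in `S` and carries every finite-entropy member of the class
        Function.support p ⊆ S ∧
        (∀ q ∈ MaxEnt.momentClass S φ u, ⊥ < MaxEnt.entropy q →
          MaxEnt.expectation q ((S \ Function.support p).indicator (fun _ => 1)) = 0) ∧
        -- exponential form, with nonnegative multipliers and finite normalization
        ∃ (lam : Γ → ℝ) (α : ℝ),
          (∀ γ, 0 ≤ lam γ) ∧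
          (∀ x, p x = (Function.support p).indicator
            (fun y => Real.exp (-α - ∑ γ, lam γ * φ γ y)) x) ∧
          IntegrableOn (fun x => Real.exp (-∑ γ, lam γ * φ γ x)) (Function.support p) volume ∧
          0 < ∫ x in Function.support p, Real.exp (-∑ γ, lam γ * φ γ x) ∧
          α = Real.log (∫ x in Function.support p, Real.exp (-∑ γ, lam γ * φ γ x)) ∧
          -- complementary slackness and the entropy formulas; `m γ` is the finite mean of `φ γ`
          ∃ m : Γ → ℝ, (∀ γ, MaxEnt.expectation p (φ γ) = (m γ : EReal)) ∧
            ∑ γ, lam γ * (m γ - u γ) = 0 ∧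
            h = α + ∑ γ, lam γ * m γ ∧
            h = α + ∑ γ, u γ * lam γ := by
  open MaxEnt in
  have hSm := hS.measurableSet
  have hfm : IsFiniteMeasure (volume.restrict S) := ⟨by simpa using hSfin.lt_top⟩
  have hν : volume.restrict S ≠ 0 := by rwa [Ne, Measure.restrict_eq_zero]
  have hφS : ∀ γ, AEStronglyMeasurable (φ γ) (volume.restrict S) :=
    fun γ => (hφ γ).restrict.aestronglyMeasurable
  have hLS : ∀ γ, ∀ᵐ x ∂(volume.restrict S), L ≤ φ γ x := fun γ => ae_restrict_of_ae (hL γ)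
  obtain ⟨C, hCsub, hCm, hCv⟩ := exists_measurableSet_feasible (u := u) hSm hφ
  have hCS : volume.restrict S C = volume (feasibleSet S φ u) := by
    rw [Measure.restrict_apply hCm, Set.inter_eq_left.2 fun x hx => (hCsub hx).1, hCv]
  obtain ⟨q₀, hq₀, hq₀e⟩ := isFinEnt_uniform (u := u) hφS hLS hCm (by rwa [hCS])
    fun x hx => (hCsub hx).2
  obtain ⟨p₁, hp₁⟩ := exists_isMaximizer hν hφS hLS ⟨q₀, hq₀⟩
  have hsm := hp₁.integrable.aestronglyMeasurable
  -- A measurable representative makes the set `A` below measurable.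
  have hp₀ : IsMaximizer (volume.restrict S) φ u (hsm.mk p₁) := hp₁.congr_ae hsm.ae_eq_mk
  have hp₀m : Measurable (hsm.mk p₁) := hsm.stronglyMeasurable_mk.measurable
  set p₀ := hsm.mk p₁
  obtain ⟨lam, hlam, hslack, hlog⟩ := hp₀.exists_multipliers
  set m : Γ → ℝ := fun γ => ∫ x in S, φ γ x * p₀ x with hm
  set h : ℝ := ∫ x in S, Real.negMulLog (p₀ x) with hh
  -- Chosen so that the entropy formula holds by definition; that it is the log-normalizer follows
  -- from `∫ p = 1` in `hZ`.
  set α : ℝ := h - ∑ γ, lam γ * m γ with hα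
  set A : Set (EuclideanSpace ℝ (Fin d)) := S ∩ {x | p₀ x ≠ 0} with hA
  have hAm : MeasurableSet A := hSm.inter (hp₀m (measurableSet_singleton 0)).compl
  -- The representative is defined by the exponential itself, so the formula holds at every point
  -- and, the exponential being positive, the support is exactly `A`.
  set p : EuclideanSpace ℝ (Fin d) → ℝ :=
    A.indicator fun y => Real.exp (-α - ∑ γ, lam γ * φ γ y) with hp
  have hsupp : Function.support p = A := by
    rw [hp, Set.support_indicator, Set.inter_eq_left]
    exact fun x _ => (Real.exp_pos _).ne'
  have hpp : p₀ =ᵐ[volume.restrict S] p := by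
    filter_upwards [hlog, hp₀.nonneg, ae_restrict_mem hSm] with x h1 h2 hxS
    by_cases hx : p₀ x = 0
    · rw [hp, Set.indicator_of_notMem fun hxA : x ∈ A => hxA.2 hx, hx]
    · rw [hp, Set.indicator_of_mem (show x ∈ A from ⟨hxS, hx⟩),
        ← Real.exp_log (h2.lt_of_ne' hx), h1 hx, hα]
      congr 1
      simp only [mul_sub, Finset.sum_sub_distrib]
      ring
  have hpM : IsMaximizer (volume.restrict S) φ u p := hp₀.congr_ae hpp
  have hz : ∀ᵐ x, x ∉ S → p x = 0 := Filter.Eventually.of_forall fun x hx =>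
    Set.indicator_of_notMem (fun hxA : x ∈ A => hx hxA.1) _
  have hpe : entropy p = (h : EReal) := by
    rw [hpM.toIsFinEnt.entropy_eq hz, hh]
    congr 1
    refine integral_congr_ae ?_
    filter_upwards [hpp] with x hx
    rw [hx]
  have hpi : Integrable p :=
    IntegrableOn.integrable_of_ae_notMem_eq_zero hpM.integrable hz
  have hexp : ∀ x, Real.exp (-∑ γ, lam γ * φ γ x)
      = Real.exp α * Real.exp (-α - ∑ γ, lam γ * φ γ x) := fun x => by
    rw [← Real.exp_add]
    congr 1
    ring
  have hZi : IntegrableOn (fun x => Real.exp (-∑ γ, lam γ * φ γ x)) A volume := by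
    simp_rw [hexp]
    exact ((integrable_indicator_iff hAm).1 hpi).const_mul _
  have hZ : ∫ x in A, Real.exp (-∑ γ, lam γ * φ γ x) = Real.exp α := by
    simp_rw [hexp]
    rw [integral_const_mul, ← integral_indicator hAm, ← hp,
      ← setIntegral_eq_integral_of_ae_compl_eq_zero hz, hpM.integral_eq_one, mul_one]
  have hsl : ∑ γ, lam γ * (m γ - u γ) = 0 := Finset.sum_eq_zero fun γ _ => hslack γ
  have hmu : ∑ γ, lam γ * m γ = ∑ γ, u γ * lam γ := by
    rw [← sub_eq_zero, ← hsl, ← Finset.sum_sub_distrib]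
    exact Finset.sum_congr rfl fun γ _ => by ring
  refine ⟨p, hpM.isMaxEnt hSm hSfin hφ hL hz, fun q hq => hq.ae_eq hSm hSfin hφ hL hpM hz, h, hpe,
    ?_, ?_, ?_, fun q hq hqe => ?_, lam, α, hlam, ?_, ?_, ?_, ?_, m, fun γ => ?_, hsl, ?_, ?_⟩
  · rw [← hCS]
    exact hq₀e.symm.trans_le (hp₀.le q₀ hq₀)
  · refine (hp₀.toIsFinEnt.ent_le_log hν).trans_eq ?_
    rw [Measure.real, Measure.restrict_apply_univ]
  · rw [hsupp]
    exact Set.inter_subset_left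
  · have hqf := isFinEnt_of_mem_momentClass hSfin hφ hL hq hqe
    have h0 : (fun x => (S \ Function.support p).indicator (fun _ => (1 : ℝ)) x * q x)
        =ᵐ[volume] 0 := by
      filter_upwards [(ae_restrict_iff' hSm).1 (hpM.ae_eq_zero_of_eq_zero hqf)] with x hx
      by_cases hxN : x ∈ S \ Function.support p
      · simp [hx hxN.1 (Function.notMem_support.1 hxN.2)]
      · simp [Set.indicator_of_notMem hxN]
    rw [expectation, extIntegral_of_integrable ((integrable_zero _ _ _).congr h0.symm),
      integral_congr_ae h0]
    simp
  · intro x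
    rw [hsupp]
  · rwa [hsupp]
  · rw [hsupp, hZ]
    exact Real.exp_pos α
  · rw [hsupp, hZ, Real.log_exp]
  · rw [hpM.toIsFeasible.expectation_eq hz γ, hm]
    congr 1
    refine integral_congr_ae ?_
    filter_upwards [hpp] with x hx
    rw [hx]
  · rw [hα]
    ring
  · rw [← hmu, hα]
    ring
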